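/- Let $n\ge 1$ and let $\mathcal G=(\{1,\dots,n\},\mathcal E,\mathsf A)$ be a weighted digraph, with adjacency matrix $\mathsf A=(a_{ij})\in\mathbb R_{\ge 0}^{n\times n}$, $a_{ij}>0$ iff $(i,j)\in\mathcal E$, that is strongly connected and weight-balanced ($\sum_j a_{ij}=\sum_j a_{ji}$ for all $i$). Let $\mathsf L=\mathsf D_{\mathrm{out}}-\mathsf A$ be its Laplacian, where $\mathsf D_{\mathrm{out}}$ is the diagonal matrix of the out-degrees $\sum_j a_{ij}$. Let $f_1,\dots,f_n:\mathbb R\to\mathbb R_{\ge 0}$ be convex and continuously differentiable, $f(P)=\sum_{i=1}^n f_i(P_i)$, $P^m,P^M\in\mathbb R^n$ and $P_l>0$. The economic dispatch (ED) problem is to minimize $f$ over $$\mathcal F_{\mathrm{ED}}=\{P\in\mathbb R^n : P^m_i\le P_i\le P^M_i \text{ for all } i,\ \mathbf 1^\top P=P_l\};$$ let $\mathcal F_{\mathrm{ED}}^*$ be its set of minimizers. Assume that $\mathcal F_{\mathrm{ED}}\neq\emptyset$, that $P^m\notin\mathcal F_{\mathrm{ED}}$ and $P^M\notin\mathcal F_{\mathrm{ED}}$,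 and that $\epsilon>0$ satisfies $2\epsilon\,\max_{P\in\mathcal F_{\mathrm{ED}}}\|\nabla f(P)\|_\infty<1$. Put $$f^\epsilon(P)=\sum_{i=1}^n f_i(P_i)+\frac1\epsilon\sum_{i=1}^n\bigl(\max\{0,P_i-P_i^M\}+\max\{0,P_i^m-P_i\}\bigr),$$ let $\partial f^\epsilon(P)$ be its generalized gradient (the convex hull of all limits $\lim_k\nabla f^\epsilon(x_k)$, where $x_k\to P$ and $f^\epsilon$ is differentiable at each $x_k$), and consider the differential inclusion $$\dot P\in-\mathsf L\,\partial f^\epsilon(P)+\frac1n\,(P_l-\mathbf 1^\top P)\,\mathbf 1 .\qquad(\ast)$$ A solution of $(\ast)$ on $[0,T]$ is an absolutely continuous map $[0,T]\to\mathbb R^n$ that satisfies $(\ast)$ for almost every $t\in[0,T]$; a trajectory is a map $[0,\infty)\to\mathbb R^n$ that is a solution on $[0,T]$ for every $T>0$. Then $\mathcal F_{\mathrm{ED}}^*\neq\emptyset$, and for every $P_0\in\mathbb R^n$: 1. there is a constant $R$, depending on $P_0$ but not on the solution or on $T$, such that every solution $P$ of $(\ast)$ on an interval $[0,T]$, $T>0$,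 with $P(0)=P_0$ satisfies $\|P(t)\|\le R$ for all $t\in[0,T]$ (in particular, all trajectories are bounded); 2. every trajectory $P$ of $(\ast)$ with $P(0)=P_0$ satisfies $P_l-\mathbf 1^\top P(t)=e^{-t}\,(P_l-\mathbf 1^\top P_0)$ for all $t\ge 0$ and converges to the set of solutions of the ED problem: $\lim_{t\to\infty}\operatorname{dist}(P(t),\mathcal F_{\mathrm{ED}}^*)=0$. -/

import Mathlib

open Set Filter Topology MeasureTheory

noncomputable section

/-- A weighted digraph on the vertex set `{1, …, n}`: a digraph with an entrywise nonnegative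
adjacency matrix whose `(i, j)` entry is positive iff `(i, j)` is an edge. -/
structure WeightedDigraph (n : ℕ) where
  graph : Digraph (Fin n)
  adjMat : Matrix (Fin n) (Fin n) ℝ
  adjMat_nonneg : ∀ i j, 0 ≤ adjMat i j
  adjMat_pos_iff : ∀ i j, 0 < adjMat i j ↔ graph.Adj i j

namespace WeightedDigraph

variable {n : ℕ}

/-- There is a directed path from any vertex to any other vertex. -/
def StronglyConnected (G : WeightedDigraph n) : Prop :=
  ∀ i j, Relation.ReflTransGen G.graph.Adj i j

/-- Weighted out-degree. -/
def outDegree (G : WeightedDigraph n) (i : Fin n) : ℝ := ∑ j, G.adjMat i j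

/-- Weighted in-degree. -/
def inDegree (G : WeightedDigraph n) (i : Fin n) : ℝ := ∑ j, G.adjMat j i

def WeightBalanced (G : WeightedDigraph n) : Prop :=
  ∀ i, G.outDegree i = G.inDegree i

/-- The Laplacian `L = D_out - A`. -/
def laplacian (G : WeightedDigraph n) : Matrix (Fin n) (Fin n) ℝ :=
  Matrix.diagonal G.outDegree - G.adjMat

end WeightedDigraph

/-- The (Clarke) generalized gradient of a locally Lipschitz function: the convex hull of all
limits of gradients `∇ f (x k)` along sequences `x k → x` of points of differentiability.
(For locally Lipschitz `f`, also avoiding a null set `S` gives the same set, for every `S`;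
here `S = ∅`.) -/
def generalizedGradient {n : ℕ} (f : EuclideanSpace ℝ (Fin n) → ℝ)
    (x : EuclideanSpace ℝ (Fin n)) : Set (EuclideanSpace ℝ (Fin n)) :=
  convexHull ℝ {g | ∃ u : ℕ → EuclideanSpace ℝ (Fin n), Tendsto u atTop (𝓝 x) ∧
    (∀ k, DifferentiableAt ℝ f (u k)) ∧ Tendsto (fun k => gradient f (u k)) atTop (𝓝 g)}

/-- `x` is a solution on `[0, T]` of the differential inclusion `x' ∈ H x`: it is absolutely
continuous there and satisfies the inclusion at almost every time. Values of `x` outside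
`[0, T]` play no role. -/
def IsSolutionOn {n : ℕ} (H : EuclideanSpace ℝ (Fin n) → Set (EuclideanSpace ℝ (Fin n)))
    (x : ℝ → EuclideanSpace ℝ (Fin n)) (T : ℝ) : Prop :=
  AbsolutelyContinuousOnInterval x 0 T ∧
    ∀ᵐ t ∂(volume.restrict (Icc 0 T)), ∃ v ∈ H (x t), HasDerivAt x v t

/-- `x` is a trajectory of `x' ∈ H x`, i.e. a solution on `[0, ∞)`. -/
def IsTrajectory {n : ℕ} (H : EuclideanSpace ℝ (Fin n) → Set (EuclideanSpace ℝ (Fin n)))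
    (x : ℝ → EuclideanSpace ℝ (Fin n)) : Prop :=
  ∀ T > 0, IsSolutionOn H x T

namespace EconomicDispatch

variable {n : ℕ}

/-- Total cost `f(P) = ∑ i, f i (P i)`. -/
def totalCost (f : Fin n → ℝ → ℝ) (P : EuclideanSpace ℝ (Fin n)) : ℝ := ∑ i, f i (P i)

/-- Allocations that satisfy the box constraints and the load condition. -/
def feasibleSet (Pm PM : EuclideanSpace ℝ (Fin n)) (Pl : ℝ) : Set (EuclideanSpace ℝ (Fin n)) :=
  {P | (∀ i, Pm i ≤ P i ∧ P i ≤ PM i) ∧ ∑ i, P i = Pl}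

/-- The solutions of the economic dispatch problem. -/
def solutionSet (f : Fin n → ℝ → ℝ) (Pm PM : EuclideanSpace ℝ (Fin n)) (Pl : ℝ) :
    Set (EuclideanSpace ℝ (Fin n)) :=
  {P | P ∈ feasibleSet Pm PM Pl ∧ IsMinOn (totalCost f) (feasibleSet Pm PM Pl) P}

/-- The penalized total cost
`f^ε(P) = ∑ i, f i (P i) + (1/ε) ∑ i, ([P i - PM i]⁺ + [Pm i - P i]⁺)`. -/
def penalizedCost (f : Fin n → ℝ → ℝ) (Pm PM : EuclideanSpace ℝ (Fin n)) (ε : ℝ)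
    (P : EuclideanSpace ℝ (Fin n)) : ℝ :=
  ∑ i, f i (P i) + 1 / ε * ∑ i, (max 0 (P i - PM i) + max 0 (Pm i - P i))

/-- The set-valued map `P ↦ -L ∂f^ε(P) + (1/n) (Pl - 1ᵀ P) 1`. -/
def lmLapGradMap (G : WeightedDigraph n) (f : Fin n → ℝ → ℝ)
    (Pm PM : EuclideanSpace ℝ (Fin n)) (Pl ε : ℝ) (P : EuclideanSpace ℝ (Fin n)) :
    Set (EuclideanSpace ℝ (Fin n)) :=
  {v | ∃ ζ ∈ generalizedGradient (penalizedCost f Pm PM ε) P,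
    v = -(Matrix.toEuclideanLin G.laplacian ζ) +
      (1 / (n : ℝ) * (Pl - ∑ i, P i)) • WithLp.toLp 2 (fun _ : Fin n => (1 : ℝ))}

end EconomicDispatch

end

/-! The penalized cost `V = f^ε` is a Lyapunov function up to an integrable error. Weight balance
gives `1ᵀL = 0`, so the mismatch `s = Pl - 1ᵀP` satisfies `s' = -s`. For almost every `t`, some
subgradient `ζ` of `f^ε` at `P t` gives `V' = -E(ζ) + (s/n) ∑ ζᵢ`, with `E` the Dirichlet form. The
last term has no sign. But the total allocation is bounded and unit costs are nonnegative, so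
`abs_subgradient_le` bounds `ζ` by a constant plus its disagreement, which is at most `√(C E)` by
the Poincaré inequality. Young's inequality then yields `V' ≤ -E/2 + L e^{-t}`.

Hence `V + L e^{-t}` is nonincreasing, and coercivity of `V` bounds solutions. Since `V ≥ 0`,
arbitrarily late times have small `E`; there `ζ` is nearly a multiple of `1` and `s` is nearly `0`,
so the subgradient inequality at a feasible `Q` makes `V` at most `f(Q)` plus a small error, and
monotonicity preserves this (`eventually_penalizedCost_le`). Limit points therefore meet the load
condition with penalized cost at most optimal. The penalty is exact
(`mem_solutionSet_of_penalizedCost_le`): the error bound with constant `2` matches `2ε‖∇f‖∞ < 1`. So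
limit points are minimizers. -/

/-! ### Subgradients of convex functions -/

/-- A differentiable convex function lies above its tangent hyperplanes. -/
theorem ConvexOn.add_inner_gradient_le {F : Type*} [NormedAddCommGroup F] [InnerProductSpace ℝ F]
    [CompleteSpace F] {f : F → ℝ} (hf : ConvexOn ℝ univ f) {x : F}
    (hx : DifferentiableAt ℝ f x) (y : F) : f x + inner ℝ (gradient f x) (y - x) ≤ f y := by
  have hg : ConvexOn ℝ univ (fun t : ℝ => f (x + t • (y - x))) := by
    have h := hf.comp_affineMap (AffineMap.lineMap x y : ℝ →ᵃ[ℝ] F)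
    have e : (f ∘ (AffineMap.lineMap x y : ℝ →ᵃ[ℝ] F)) = fun t : ℝ => f (x + t • (y - x)) := by
      ext t
      simp [AffineMap.lineMap_apply, add_comm]
    rwa [e, preimage_univ] at h
  have hd : HasDerivAt (fun t : ℝ => f (x + t • (y - x))) (inner ℝ (gradient f x) (y - x)) 0 := by
    have h1 : HasDerivAt (fun t : ℝ => x + t • (y - x)) (y - x) 0 := by
      simpa using ((hasDerivAt_id (0 : ℝ)).smul_const (y - x)).const_add x
    have h2 := hx.hasGradientAt.hasFDerivAt
    have h3 := HasFDerivAt.comp_hasDerivAt_of_eq (0 : ℝ) h2 h1 (by simp)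
    simpa [Function.comp_def] using h3
  have h := hg.le_slope_of_hasDerivAt (mem_univ 0) (mem_univ 1) one_pos hd
  simp only [slope_def_field, zero_smul, one_smul, add_zero, sub_zero, div_one,
    add_sub_cancel] at h
  linarith

/-- Elements of the generalized gradient of a convex function are subgradients. -/
theorem ConvexOn.add_inner_le_of_mem_generalizedGradient {n : ℕ}
    {f : EuclideanSpace ℝ (Fin n) → ℝ} (hf : ConvexOn ℝ univ f) {x ζ : EuclideanSpace ℝ (Fin n)}
    (hζ : ζ ∈ generalizedGradient f x) (y : EuclideanSpace ℝ (Fin n)) :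
    f x + inner ℝ ζ (y - x) ≤ f y := by
  -- The inequality is affine in `g`, so it passes to convex hulls; being closed, it also passes to
  -- limits of gradients.
  have hconv : Convex ℝ {g : EuclideanSpace ℝ (Fin n) | f x + inner ℝ g (y - x) ≤ f y} := by
    intro g hg g' hg' a b ha hb hab
    simp only [mem_ofPred_eq] at *
    rw [inner_add_left, real_inner_smul_left, real_inner_smul_left]
    obtain rfl : b = 1 - a := by linarith
    nlinarith [mul_le_mul_of_nonneg_left hg ha, mul_le_mul_of_nonneg_left hg' hb]
  refine convexHull_min ?_ hconv hζ
  rintro g ⟨u, hu, hd, hg⟩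
  have hcf : Continuous f := hf.locallyLipschitz.continuous
  have ht : Tendsto (fun k => f (u k) + inner ℝ (gradient f (u k)) (y - u k)) atTop
      (𝓝 (f x + inner ℝ g (y - x))) :=
    ((hcf.tendsto x).comp hu).add (hg.inner (tendsto_const_nhds.sub hu))
  exact le_of_tendsto ht (Eventually.of_forall fun k => hf.add_inner_gradient_le (hd k) y)

/-! ### Absolutely continuous curves -/

theorem LipschitzOnWith.comp_absolutelyContinuousOnInterval {X Y : Type*}
    [PseudoMetricSpace X] [PseudoMetricSpace Y] {g : X → Y} {s : Set X} {K : NNReal}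
    (hg : LipschitzOnWith K g s) {x : ℝ → X} {a b : ℝ} (hx : AbsolutelyContinuousOnInterval x a b)
    (hs : MapsTo x (uIcc a b) s) :
    AbsolutelyContinuousOnInterval (fun t => g (x t)) a b := by
  rw [absolutelyContinuousOnInterval_iff] at hx ⊢
  intro ε hε
  -- `K + 1` rather than `K`, since `K` may vanish.
  obtain ⟨δ, hδ, h⟩ := hx (ε / (K + 1)) (by positivity)
  refine ⟨δ, hδ, fun E hE hEδ => ?_⟩
  have hE' := h E hE hEδ
  have hK : (0 : ℝ) < K + 1 := by positivity
  rw [lt_div_iff₀ hK] at hE'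
  have hnn : 0 ≤ ∑ i ∈ Finset.range E.1, dist (x (E.2 i).1) (x (E.2 i).2) :=
    Finset.sum_nonneg fun i _ => dist_nonneg
  calc ∑ i ∈ Finset.range E.1, dist (g (x (E.2 i).1)) (g (x (E.2 i).2))
      ≤ ∑ i ∈ Finset.range E.1, K * dist (x (E.2 i).1) (x (E.2 i).2) :=
        Finset.sum_le_sum fun i hi =>
          hg.dist_le_mul _ (hs (hE.1 i hi).1) _ (hs (hE.1 i hi).2)
    _ = K * ∑ i ∈ Finset.range E.1, dist (x (E.2 i).1) (x (E.2 i).2) := by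
        rw [Finset.mul_sum]
    _ < ε := by nlinarith

/-- The image of the curve is compact, which makes the Lipschitz constant uniform. Used for the
convex function `f^ε`, whose values along a solution can then be recovered from their derivative. -/
theorem LocallyLipschitz.comp_absolutelyContinuousOnInterval {X Y : Type*}
    [SeminormedAddCommGroup X] [PseudoMetricSpace Y] {g : X → Y}
    (hg : LocallyLipschitz g) {x : ℝ → X} {a b : ℝ} (hx : AbsolutelyContinuousOnInterval x a b) :
    AbsolutelyContinuousOnInterval (fun t => g (x t)) a b := by
  have hc : IsCompact (x '' uIcc a b) :=
    isCompact_uIcc.image_of_continuousOn hx.continuousOn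
  obtain ⟨K, hK⟩ := LocallyLipschitzOn.exists_lipschitzOnWith_of_compact hc
    (hg.locallyLipschitzOn (s := x '' uIcc a b))
  exact hK.comp_absolutelyContinuousOnInterval hx (mapsTo_image _ _)

/-- An absolutely continuous function with almost everywhere nonpositive derivative decreases. -/
theorem AbsolutelyContinuousOnInterval.le_of_ae_deriv_nonpos {φ : ℝ → ℝ} {a b : ℝ} (hab : a ≤ b)
    (hφ : AbsolutelyContinuousOnInterval φ a b)
    (h : ∀ᵐ t, t ∈ Icc a b → DifferentiableAt ℝ φ t → deriv φ t ≤ 0) : φ b ≤ φ a := by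
  have hd := hφ.ae_differentiableAt
  rw [uIcc_of_le hab] at hd
  have h0 : ∫ t in a..b, deriv φ t ≤ ∫ _ in a..b, (0 : ℝ) := by
    refine intervalIntegral.integral_mono_ae_restrict hab hφ.intervalIntegrable_deriv
      (by simp) ?_
    rw [EventuallyLE, ae_restrict_iff' measurableSet_Icc]
    filter_upwards [h, hd] with t ht1 ht2 ht
    exact ht1 ht (ht2 ht)
  rw [hφ.integral_deriv_eq_sub] at h0
  simpa using h0

/-- Chain rule along a curve for a function with a subgradient `ζ` at `x t`. -/
theorem deriv_comp_eq_inner_of_subgradient {F : Type*} [NormedAddCommGroup F]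
    [InnerProductSpace ℝ F] {f : F → ℝ} {x : ℝ → F} {v ζ : F} {t : ℝ}
    (hx : HasDerivAt x v t) (hζ : ∀ y, f (x t) + inner ℝ ζ (y - x t) ≤ f y)
    (hd : DifferentiableAt ℝ (fun s => f (x s)) t) :
    deriv (fun s => f (x s)) t = inner ℝ ζ v := by
  -- The gap to the supporting affine function is minimal at `t`, so its derivative vanishes; `f`
  -- itself need not be differentiable at `x t`.
  have hmin : IsLocalMin (fun s => f (x s) - inner ℝ ζ (x s)) t := by
    refine Eventually.of_forall fun s => ?_
    have := hζ (x s)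
    rw [inner_sub_right] at this
    simp only
    linarith
  have h1 : HasDerivAt (fun s => inner ℝ ζ (x s)) (inner ℝ ζ v) t := by
    simpa using (hasDerivAt_const t ζ).inner ℝ hx
  have := hmin.hasDerivAt_eq_zero (hd.hasDerivAt.sub h1)
  linarith

/-! ### Laplacian of a weight-balanced digraph -/

namespace WeightedDigraph

variable {n : ℕ}

/-- The quadratic form `½ ∑ aᵢⱼ (ζᵢ - ζⱼ)²` of the Laplacian. -/
noncomputable def dirichletForm (G : WeightedDigraph n) (ζ : EuclideanSpace ℝ (Fin n)) : ℝ :=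
  1 / 2 * ∑ i, ∑ j, G.adjMat i j * (ζ i - ζ j) ^ 2

theorem dirichletForm_nonneg (G : WeightedDigraph n) (ζ : EuclideanSpace ℝ (Fin n)) :
    0 ≤ G.dirichletForm ζ :=
  mul_nonneg (by norm_num) <| Finset.sum_nonneg fun i _ => Finset.sum_nonneg fun j _ =>
    mul_nonneg (G.adjMat_nonneg i j) (sq_nonneg _)

theorem toEuclideanLin_laplacian_apply (G : WeightedDigraph n) (ζ : EuclideanSpace ℝ (Fin n))
    (i : Fin n) : Matrix.toEuclideanLin G.laplacian ζ i =
      ∑ j, G.adjMat i j * (ζ i - ζ j) := by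
  simp [laplacian, Matrix.toLpLin_apply, outDegree,
    mul_sub, Finset.sum_sub_distrib, Finset.sum_mul, Matrix.mulVec, dotProduct,
    Matrix.diagonal_apply]

/-- Weight balance enters through this identity: column sums of the adjacency matrix equal row sums.
-/
theorem sum_adjMat_mul_swap (G : WeightedDigraph n) (hG : G.WeightBalanced) (h : Fin n → ℝ) :
    ∑ i, ∑ j, G.adjMat i j * h j = ∑ i, ∑ j, G.adjMat i j * h i := by
  rw [Finset.sum_comm]
  refine Finset.sum_congr rfl fun j _ => ?_
  rw [← Finset.sum_mul, ← Finset.sum_mul]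
  exact congrArg (· * h j) (hG j).symm

theorem sum_toEuclideanLin_laplacian (G : WeightedDigraph n) (hG : G.WeightBalanced)
    (ζ : EuclideanSpace ℝ (Fin n)) : ∑ i, Matrix.toEuclideanLin G.laplacian ζ i = 0 := by
  simp only [toEuclideanLin_laplacian_apply, mul_sub, Finset.sum_sub_distrib]
  rw [G.sum_adjMat_mul_swap hG, sub_self]

theorem sum_mul_toEuclideanLin_laplacian (G : WeightedDigraph n) (hG : G.WeightBalanced)
    (ζ : EuclideanSpace ℝ (Fin n)) :
    ∑ i, ζ i * Matrix.toEuclideanLin G.laplacian ζ i = G.dirichletForm ζ := by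
  have h := G.sum_adjMat_mul_swap hG fun i => ζ i ^ 2
  have e : ∑ i, ∑ j, G.adjMat i j * (ζ i - ζ j) ^ 2 =
      ∑ i, ∑ j, G.adjMat i j * ζ i ^ 2 + ∑ i, ∑ j, G.adjMat i j * ζ j ^ 2
        - 2 * ∑ i, ∑ j, G.adjMat i j * (ζ i * ζ j) := by
    simp only [Finset.mul_sum, ← Finset.sum_add_distrib, ← Finset.sum_sub_distrib]
    exact Finset.sum_congr rfl fun i _ => Finset.sum_congr rfl fun j _ => by ring
  have e' : ∑ i, ζ i * Matrix.toEuclideanLin G.laplacian ζ i =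
      ∑ i, ∑ j, G.adjMat i j * ζ i ^ 2 - ∑ i, ∑ j, G.adjMat i j * (ζ i * ζ j) := by
    simp only [toEuclideanLin_laplacian_apply, Finset.mul_sum, ← Finset.sum_sub_distrib]
    exact Finset.sum_congr rfl fun i _ => Finset.sum_congr rfl fun j _ => by ring
  rw [dirichletForm, e, e']
  linarith

theorem adjMat_mul_sq_le_dirichletForm (G : WeightedDigraph n) (ζ : EuclideanSpace ℝ (Fin n))
    (i j : Fin n) : G.adjMat i j * (ζ i - ζ j) ^ 2 ≤ 2 * G.dirichletForm ζ := by
  have hnn : ∀ i j, 0 ≤ G.adjMat i j * (ζ i - ζ j) ^ 2 := fun i j =>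
    mul_nonneg (G.adjMat_nonneg i j) (sq_nonneg _)
  have h1 := Finset.single_le_sum (fun j _ => hnn i j) (Finset.mem_univ j)
  have h2 := Finset.single_le_sum (f := fun i => ∑ j, G.adjMat i j * (ζ i - ζ j) ^ 2)
    (fun i _ => Finset.sum_nonneg fun j _ => hnn i j) (Finset.mem_univ i)
  rw [dirichletForm]
  simp only at h1 h2
  linarith

/-- Induction along a path with `(a + b)² ≤ 2a² + 2b²`; each edge costs `2 / a`, as the form carries
a factor `½`. -/
theorem exists_sq_sub_le_of_reflTransGen (G : WeightedDigraph n) {i j : Fin n}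
    (h : Relation.ReflTransGen G.graph.Adj i j) :
    ∃ C : ℝ, 0 ≤ C ∧ ∀ ζ : EuclideanSpace ℝ (Fin n), (ζ i - ζ j) ^ 2 ≤ C * G.dirichletForm ζ := by
  induction h with
  | refl => exact ⟨0, le_rfl, fun ζ => by simp⟩
  | @tail j k _ hjk ih =>
    obtain ⟨C, hC, h⟩ := ih
    have ha := (G.adjMat_pos_iff j k).2 hjk
    refine ⟨2 * C + 2 * (2 / G.adjMat j k), by positivity, fun ζ => ?_⟩
    have h1 : (ζ j - ζ k) ^ 2 ≤ 2 / G.adjMat j k * G.dirichletForm ζ := by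
      rw [div_mul_eq_mul_div, le_div_iff₀ ha, mul_comm]
      exact G.adjMat_mul_sq_le_dirichletForm ζ j k
    nlinarith [h ζ, sq_nonneg ((ζ i - ζ j) - (ζ j - ζ k))]

/-- Poincaré inequality on a strongly connected digraph. -/
theorem StronglyConnected.exists_sq_sub_le {G : WeightedDigraph n} (hG : G.StronglyConnected) :
    ∃ C : ℝ, 0 ≤ C ∧ ∀ (ζ : EuclideanSpace ℝ (Fin n)) (i j : Fin n),
      (ζ i - ζ j) ^ 2 ≤ C * G.dirichletForm ζ := by
  choose C hC h using fun i j => G.exists_sq_sub_le_of_reflTransGen (hG i j)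
  refine ⟨∑ i, ∑ j, C i j, Finset.sum_nonneg fun i _ => Finset.sum_nonneg fun j _ => hC i j,
    fun ζ i j => (h i j ζ).trans (mul_le_mul_of_nonneg_right ?_ (G.dirichletForm_nonneg ζ))⟩
  exact (Finset.single_le_sum (fun j _ => hC i j) (Finset.mem_univ j)).trans
    (Finset.single_le_sum (f := fun i => ∑ j, C i j)
      (fun i _ => Finset.sum_nonneg fun j _ => hC i j) (Finset.mem_univ i))

end WeightedDigraph

/-! ### Penalty, error bound and exactness -/

namespace EconomicDispatch

variable {n : ℕ}

/-- Total violation of the box constraints. -/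
noncomputable def boxPenalty (Pm PM P : EuclideanSpace ℝ (Fin n)) : ℝ :=
  ∑ i, (max 0 (P i - PM i) + max 0 (Pm i - P i))

theorem penalizedCost_eq_add (f : Fin n → ℝ → ℝ) (Pm PM : EuclideanSpace ℝ (Fin n)) (ε : ℝ)
    (P : EuclideanSpace ℝ (Fin n)) :
    penalizedCost f Pm PM ε P = totalCost f P + 1 / ε * boxPenalty Pm PM P := rfl

theorem boxPenalty_nonneg (Pm PM P : EuclideanSpace ℝ (Fin n)) : 0 ≤ boxPenalty Pm PM P :=
  Finset.sum_nonneg fun _ _ => add_nonneg (le_max_left _ _) (le_max_left _ _)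

theorem le_boxPenalty (Pm PM P : EuclideanSpace ℝ (Fin n)) (i : Fin n) :
    max 0 (P i - PM i) + max 0 (Pm i - P i) ≤ boxPenalty Pm PM P :=
  Finset.single_le_sum (f := fun i => max 0 (P i - PM i) + max 0 (Pm i - P i))
    (fun _ _ => add_nonneg (le_max_left _ _) (le_max_left _ _)) (Finset.mem_univ i)

theorem boxPenalty_eq_zero {Pm PM P : EuclideanSpace ℝ (Fin n)}
    (h : ∀ i, Pm i ≤ P i ∧ P i ≤ PM i) : boxPenalty Pm PM P = 0 :=
  Finset.sum_eq_zero fun i _ => by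
    rw [max_eq_left (sub_nonpos.2 (h i).2), max_eq_left (sub_nonpos.2 (h i).1), add_zero]

theorem mem_box_of_boxPenalty_nonpos {Pm PM P : EuclideanSpace ℝ (Fin n)}
    (h : boxPenalty Pm PM P ≤ 0) (i : Fin n) : Pm i ≤ P i ∧ P i ≤ PM i := by
  have := le_boxPenalty Pm PM P i
  have h1 := le_max_left 0 (P i - PM i)
  have h2 := le_max_left 0 (Pm i - P i)
  have h3 := le_max_right 0 (P i - PM i)
  have h4 := le_max_right 0 (Pm i - P i)
  constructor <;> linarith

theorem convexOn_totalCost {f : Fin n → ℝ → ℝ} (hf : ∀ i, ConvexOn ℝ univ (f i)) :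
    ConvexOn ℝ univ (totalCost f) := by
  refine ⟨convex_univ, fun x _ y _ a b ha hb hab => ?_⟩
  simp only [totalCost, smul_eq_mul, Finset.mul_sum, ← Finset.sum_add_distrib]
  exact Finset.sum_le_sum fun i _ => (hf i).2 (mem_univ (x i)) (mem_univ (y i)) ha hb hab

/-- Cost of one unit, including its share of the penalty. -/
noncomputable def unitCost (f : Fin n → ℝ → ℝ) (Pm PM : EuclideanSpace ℝ (Fin n)) (ε : ℝ) (i : Fin n)
    (x : ℝ) : ℝ :=
  f i x + 1 / ε * (max 0 (x - PM i) + max 0 (Pm i - x))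

/-- Separability survives penalization, so facts about `totalCost` apply to `f^ε`. -/
theorem penalizedCost_eq_totalCost (f : Fin n → ℝ → ℝ) (Pm PM : EuclideanSpace ℝ (Fin n))
    (ε : ℝ) : penalizedCost f Pm PM ε = totalCost (unitCost f Pm PM ε) := by
  ext P
  simp only [penalizedCost, totalCost, unitCost, Finset.sum_add_distrib, Finset.mul_sum, mul_add]

theorem unitCost_nonneg {f : Fin n → ℝ → ℝ} (hf : ∀ i x, 0 ≤ f i x)
    (Pm PM : EuclideanSpace ℝ (Fin n)) {ε : ℝ} (hε : 0 < ε) (i : Fin n) (x : ℝ) :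
    0 ≤ unitCost f Pm PM ε i x :=
  add_nonneg (hf i x) (mul_nonneg (by positivity)
    (add_nonneg (le_max_left _ _) (le_max_left _ _)))

theorem convexOn_unitCost {f : Fin n → ℝ → ℝ} (hf : ∀ i, ConvexOn ℝ univ (f i))
    (Pm PM : EuclideanSpace ℝ (Fin n)) {ε : ℝ} (hε : 0 < ε) (i : Fin n) :
    ConvexOn ℝ univ (unitCost f Pm PM ε i) := by
  have h0 : ConvexOn ℝ univ fun _ : ℝ => (0 : ℝ) := convexOn_const 0 convex_univ
  have h1 : ConvexOn ℝ univ fun x : ℝ => x - PM i :=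
    (convexOn_id convex_univ).sub (concaveOn_const (PM i) convex_univ)
  have h2 : ConvexOn ℝ univ fun x : ℝ => Pm i - x :=
    (convexOn_const (Pm i) convex_univ).sub (concaveOn_id convex_univ)
  exact (hf i).add (((h0.sup h1).add (h0.sup h2)).smul (by positivity : 0 ≤ 1 / ε))

theorem convexOn_penalizedCost {f : Fin n → ℝ → ℝ} (hf : ∀ i, ConvexOn ℝ univ (f i))
    (Pm PM : EuclideanSpace ℝ (Fin n)) {ε : ℝ} (hε : 0 < ε) :
    ConvexOn ℝ univ (penalizedCost f Pm PM ε) := by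
  rw [penalizedCost_eq_totalCost]
  exact convexOn_totalCost (convexOn_unitCost hf Pm PM hε)

theorem differentiable_totalCost {f : Fin n → ℝ → ℝ} (hf : ∀ i, ContDiff ℝ 1 (f i)) :
    Differentiable ℝ (totalCost f) := by
  have h : ∀ i, Differentiable ℝ (f i) := fun i => (hf i).differentiable one_ne_zero
  unfold totalCost
  fun_prop

/-- The feasible set is at `ℓ¹`-distance `|1ᵀQ - Pl|` from any point `Q` of the box. -/
theorem exists_feasible_of_mem_box {Pm PM : EuclideanSpace ℝ (Fin n)} {Pl : ℝ}
    (hne : (feasibleSet Pm PM Pl).Nonempty) {Q : EuclideanSpace ℝ (Fin n)}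
    (hQ : ∀ i, Pm i ≤ Q i ∧ Q i ≤ PM i) :
    ∃ P ∈ feasibleSet Pm PM Pl, ∑ i, |Q i - P i| = |∑ i, Q i - Pl| := by
  obtain ⟨P₀, hbox, hsum⟩ := hne
  rcases le_total Pl (∑ i, Q i) with h | h
  · have hm : ∑ i, Pm i ≤ Pl := hsum ▸ Finset.sum_le_sum fun i _ => (hbox i).1
    -- `θ` is the fraction of the way from `Q` to `Pm` that removes the excess load. All coordinates
    -- move in the same direction, so the `ℓ¹` length equals the change of the sum.
    obtain ⟨θ, h0, h1, hθ⟩ : ∃ θ : ℝ, 0 ≤ θ ∧ θ ≤ 1 ∧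
        θ * (∑ i, Q i - ∑ i, Pm i) = ∑ i, Q i - Pl := by
      rcases (hm.trans h).eq_or_lt with e | e
      · exact ⟨0, le_rfl, zero_le_one, by linarith⟩
      · have : 0 < ∑ i, Q i - ∑ i, Pm i := by linarith
        exact ⟨(∑ i, Q i - Pl) / (∑ i, Q i - ∑ i, Pm i), div_nonneg (by linarith) this.le,
          (div_le_one this).2 (by linarith), div_mul_cancel₀ _ this.ne'⟩
    refine ⟨WithLp.toLp 2 fun i => Q i - θ * (Q i - Pm i), ⟨fun i => ?_, ?_⟩, ?_⟩
    · have := hQ i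
      constructor <;> simp only <;> nlinarith
    · simp only [Finset.sum_sub_distrib, ← Finset.mul_sum]
      linarith
    · rw [abs_of_nonneg (by linarith), ← hθ, ← Finset.sum_sub_distrib, Finset.mul_sum]
      refine Finset.sum_congr rfl fun i _ => ?_
      rw [sub_sub_cancel, abs_of_nonneg (mul_nonneg h0 (by linarith [(hQ i).1]))]
  · have hm : Pl ≤ ∑ i, PM i := hsum ▸ Finset.sum_le_sum fun i _ => (hbox i).2
    obtain ⟨θ, h0, h1, hθ⟩ : ∃ θ : ℝ, 0 ≤ θ ∧ θ ≤ 1 ∧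
        θ * (∑ i, PM i - ∑ i, Q i) = Pl - ∑ i, Q i := by
      rcases (h.trans hm).eq_or_lt with e | e
      · exact ⟨0, le_rfl, zero_le_one, by linarith⟩
      · have : 0 < ∑ i, PM i - ∑ i, Q i := by linarith
        exact ⟨(Pl - ∑ i, Q i) / (∑ i, PM i - ∑ i, Q i), div_nonneg (by linarith) this.le,
          (div_le_one this).2 (by linarith), div_mul_cancel₀ _ this.ne'⟩
    refine ⟨WithLp.toLp 2 fun i => Q i + θ * (PM i - Q i), ⟨fun i => ?_, ?_⟩, ?_⟩
    · have := hQ i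
      constructor <;> simp only <;> nlinarith
    · simp only [Finset.sum_add_distrib, Finset.sum_sub_distrib, ← Finset.mul_sum]
      linarith
    · rw [abs_of_nonpos (by linarith), neg_sub, ← hθ, ← Finset.sum_sub_distrib, Finset.mul_sum]
      refine Finset.sum_congr rfl fun i _ => ?_
      rw [sub_add_cancel_left, abs_neg, abs_of_nonneg (mul_nonneg h0 (by linarith [(hQ i).2]))]

/-- Error bound: the `ℓ¹`-distance from a point that meets the load condition to the feasible set
is at most twice the violation of the box constraints. -/
theorem exists_feasible_sum_abs_sub_le {Pm PM : EuclideanSpace ℝ (Fin n)} {Pl : ℝ}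
    (hne : (feasibleSet Pm PM Pl).Nonempty) {P : EuclideanSpace ℝ (Fin n)}
    (hP : ∑ i, P i = Pl) :
    ∃ P' ∈ feasibleSet Pm PM Pl, ∑ i, |P i - P' i| ≤ 2 * boxPenalty Pm PM P := by
  have hle : ∀ i, Pm i ≤ PM i := fun i => (hne.some_mem.1 i).1.trans (hne.some_mem.1 i).2
  -- `Q` is the projection of `P` onto the box; the penalty is exactly the `ℓ¹` distance to it.
  set Q : EuclideanSpace ℝ (Fin n) := WithLp.toLp 2 fun i => max (Pm i) (min (P i) (PM i)) with hQ
  have hQP : ∑ i, |P i - Q i| = boxPenalty Pm PM P := by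
    refine Finset.sum_congr rfl fun i _ => ?_
    have := hle i
    simp only [hQ]
    grind
  obtain ⟨P', hP', h⟩ := exists_feasible_of_mem_box hne (Q := Q)
    fun i => ⟨le_max_left _ _, max_le (hle i) (min_le_right _ _)⟩
  refine ⟨P', hP', ?_⟩
  have h1 : ∑ i, |P i - P' i| ≤ ∑ i, |P i - Q i| + ∑ i, |Q i - P' i| := by
    rw [← Finset.sum_add_distrib]
    exact Finset.sum_le_sum fun i _ => abs_sub_le _ _ _
  -- Clamping changes the total by at most the penalty, so restoring the load costs at most the
  -- penalty again: hence the factor `2`.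
  have h2 : |∑ i, Q i - Pl| ≤ ∑ i, |P i - Q i| := by
    rw [← hP, abs_sub_comm, ← Finset.sum_sub_distrib]
    exact Finset.abs_sum_le_sum_abs _ _
  linarith

/-- Exactness of the penalty. -/
theorem mem_solutionSet_of_penalizedCost_le {f : Fin n → ℝ → ℝ}
    (hf_convex : ∀ i, ConvexOn ℝ univ (f i)) (hf_C1 : ∀ i, ContDiff ℝ 1 (f i))
    {Pm PM : EuclideanSpace ℝ (Fin n)} {Pl ε : ℝ} (hε : 0 < ε)
    (hε_lt : ∀ P ∈ feasibleSet Pm PM Pl, ε * (2 * ‖WithLp.ofLp (gradient (totalCost f) P)‖) < 1)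
    {Q P : EuclideanSpace ℝ (Fin n)} (hQ : Q ∈ solutionSet f Pm PM Pl) (hP : ∑ i, P i = Pl)
    (h : penalizedCost f Pm PM ε P ≤ totalCost f Q) : P ∈ solutionSet f Pm PM Pl := by
  obtain ⟨P', hP', hd⟩ := exists_feasible_sum_abs_sub_le ⟨Q, hQ.1⟩ hP
  have hgrad := (convexOn_totalCost hf_convex).add_inner_gradient_le
    (differentiable_totalCost hf_C1 P') P
  -- `WithLp.ofLp` lands in the function space, so this is the sup norm, dual to `ℓ¹`.
  set M := ‖WithLp.ofLp (gradient (totalCost f) P')‖ with hM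
  have hM0 : 0 ≤ M := norm_nonneg _
  have hpen := boxPenalty_nonneg Pm PM P
  have hinner : -(M * ∑ i, |P i - P' i|) ≤ inner ℝ (gradient (totalCost f) P') (P - P') := by
    rw [PiLp.inner_apply, Finset.mul_sum, ← Finset.sum_neg_distrib]
    refine Finset.sum_le_sum fun i _ => ?_
    have h1 : |gradient (totalCost f) P' i| ≤ M :=
      norm_le_pi_norm (WithLp.ofLp (gradient (totalCost f) P')) i
    have h2 : |inner ℝ (gradient (totalCost f) P' i) ((P - P') i)| ≤ M * |P i - P' i| := by
      simp only [PiLp.sub_apply, RCLike.inner_apply, conj_trivial, abs_mul]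
      rw [mul_comm]
      exact mul_le_mul_of_nonneg_right h1 (abs_nonneg _)
    linarith [neg_abs_le (inner ℝ (gradient (totalCost f) P' i) ((P - P') i))]
  have hmin : totalCost f Q ≤ totalCost f P' := hQ.2 hP'
  rw [penalizedCost_eq_add] at h
  have hlt : 2 * M < 1 / ε := by
    rw [lt_div_iff₀ hε, mul_comm]
    exact hε_lt P' hP'
  -- Combining the bounds gives `(1/ε - 2M) * boxPenalty ≤ 0` with a positive first factor.
  have hzero : boxPenalty Pm PM P ≤ 0 := by nlinarith [mul_le_mul_of_nonneg_left hd hM0]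
  have hcost : totalCost f P ≤ totalCost f Q := by
    have : 0 ≤ 1 / ε * boxPenalty Pm PM P := by positivity
    linarith
  exact ⟨⟨mem_box_of_boxPenalty_nonpos hzero, hP⟩, fun P'' hP'' => hcost.trans (hQ.2 hP'')⟩

theorem norm_le_sum_abs (P : EuclideanSpace ℝ (Fin n)) : ‖P‖ ≤ ∑ i, |P i| := by
  rw [EuclideanSpace.norm_eq]
  refine Real.sqrt_le_iff.2 ⟨Finset.sum_nonneg fun i _ => abs_nonneg _, ?_⟩
  simp only [Real.norm_eq_abs]
  exact Finset.sum_sq_le_sq_sum_of_nonneg fun i _ => abs_nonneg _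

/-- Coercivity: as `f ≥ 0`, the penalty is at most `ε * c`, and it controls how far each coordinate
leaves its interval. -/
theorem norm_le_of_penalizedCost_le {f : Fin n → ℝ → ℝ} (hf : ∀ i x, 0 ≤ f i x)
    (Pm PM : EuclideanSpace ℝ (Fin n)) {ε : ℝ} (hε : 0 < ε) {c : ℝ}
    {P : EuclideanSpace ℝ (Fin n)} (h : penalizedCost f Pm PM ε P ≤ c) :
    ‖P‖ ≤ ∑ i, (|Pm i| + |PM i| + ε * c) := by
  refine (norm_le_sum_abs P).trans (Finset.sum_le_sum fun i _ => ?_)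
  rw [penalizedCost_eq_add] at h
  have h0 : 0 ≤ totalCost f P := Finset.sum_nonneg fun i _ => hf i _
  have h1 : boxPenalty Pm PM P ≤ ε * c := by
    have : 1 / ε * boxPenalty Pm PM P ≤ c := by linarith
    rwa [one_div, inv_mul_le_iff₀ hε] at this
  have := le_boxPenalty Pm PM P i
  have h1 := le_max_left 0 (P i - PM i)
  have h2 := le_max_left 0 (Pm i - P i)
  have h3 := le_max_right 0 (P i - PM i)
  have h4 := le_max_right 0 (Pm i - P i)
  rw [abs_le]
  constructor <;> linarith [le_abs_self (Pm i), neg_abs_le (Pm i), le_abs_self (PM i),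
    neg_abs_le (PM i), abs_nonneg (Pm i), abs_nonneg (PM i)]

theorem isCompact_feasibleSet (Pm PM : EuclideanSpace ℝ (Fin n)) (Pl : ℝ) :
    IsCompact (feasibleSet Pm PM Pl) := by
  refine Metric.isCompact_of_isClosed_isBounded ?_ ?_
  · simp only [feasibleSet, ofPred_and, ofPred_forall]
    refine IsClosed.inter (isClosed_iInter fun i => IsClosed.inter ?_ ?_) ?_
    · exact isClosed_le (by fun_prop) (by fun_prop)
    · exact isClosed_le (by fun_prop) (by fun_prop)
    · exact isClosed_eq (by fun_prop) (by fun_prop)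
  · refine isBounded_iff_forall_norm_le.2 ⟨∑ i, (|Pm i| + |PM i| + 1 * 0), fun P hP => ?_⟩
    refine norm_le_of_penalizedCost_le (f := fun _ _ => 0) (fun _ _ => le_rfl) Pm PM one_pos ?_
    rw [penalizedCost_eq_add, boxPenalty_eq_zero hP.1]
    simp [totalCost]

theorem solutionSet_nonempty {f : Fin n → ℝ → ℝ} (hf_C1 : ∀ i, ContDiff ℝ 1 (f i))
    {Pm PM : EuclideanSpace ℝ (Fin n)} {Pl : ℝ} (hne : (feasibleSet Pm PM Pl).Nonempty) :
    (solutionSet f Pm PM Pl).Nonempty := by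
  obtain ⟨P, hP, h⟩ := (isCompact_feasibleSet Pm PM Pl).exists_isMinOn hne
    (differentiable_totalCost hf_C1).continuous.continuousOn
  exact ⟨P, hP, h⟩

/-! ### A priori subgradient bounds and dissipation -/

theorem add_mul_le_of_subgradient {g : Fin n → ℝ → ℝ} {P ζ : EuclideanSpace ℝ (Fin n)}
    (hζ : ∀ y, totalCost g P + inner ℝ ζ (y - P) ≤ totalCost g y) (i : Fin n) (x : ℝ) :
    g i (P i) + ζ i * (x - P i) ≤ g i x := by
  have h := hζ (P + EuclideanSpace.single i (x - P i))
  have hs : totalCost g (P + EuclideanSpace.single i (x - P i)) - totalCost g P =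
      g i x - g i (P i) := by
    rw [totalCost, totalCost, ← Finset.sum_sub_distrib, Finset.sum_eq_single i]
    · simp
    · intro j _ hj
      simp [hj]
    · simp
  rw [add_sub_cancel_left, EuclideanSpace.inner_single_right] at h
  simp only [conj_trivial] at h
  linarith

theorem exists_apply_le_of_abs_sum_le (hn : 1 ≤ n) {P : Fin n → ℝ} {K : ℝ}
    (hK : |∑ i, P i| ≤ K) : ∃ i, P i ≤ K := by
  by_contra! h
  have hK0 : 0 ≤ K := (abs_nonneg _).trans hK
  have h1 := Finset.single_le_sum (f := P) (fun i _ => hK0.trans (h i).le)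
    (Finset.mem_univ (⟨0, hn⟩ : Fin n))
  linarith [h ⟨0, hn⟩, le_abs_self (∑ i, P i)]

/-- A priori bound on subgradients of a separable nonnegative cost, in terms of the total
allocation and of the disagreement among the entries. -/
theorem abs_subgradient_le (hn : 1 ≤ n) {g : Fin n → ℝ → ℝ} (hg : ∀ i x, 0 ≤ g i x)
    {P ζ : EuclideanSpace ℝ (Fin n)}
    (hζ : ∀ y, totalCost g P + inner ℝ ζ (y - P) ≤ totalCost g y) {K D : ℝ}
    (hK : |∑ i, P i| ≤ K) (hD : ∀ i j, |ζ i - ζ j| ≤ D) (j : Fin n) :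
    |ζ j| ≤ ∑ i, (g i (K + 1) + g i (-K - 1)) + D := by
  have hB : ∀ i, g i (K + 1) + g i (-K - 1) ≤ ∑ i, (g i (K + 1) + g i (-K - 1)) := fun i =>
    Finset.single_le_sum (f := fun i => g i (K + 1) + g i (-K - 1))
      (fun i _ => add_nonneg (hg i _) (hg i _)) (Finset.mem_univ i)
  rw [abs_le]
  constructor
  -- Some `P i ≥ -K`, so `-K - 1` lies at least one unit to its left. If `ζ j` were too negative, so
  -- would be `ζ i`, and the subgradient inequality there would force `g i (-K - 1)` above its share
  -- of the bound. The upper bound is symmetric.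
  · obtain ⟨i, hi⟩ := exists_apply_le_of_abs_sum_le hn (P := fun i => -P i) (K := K)
      (by rwa [Finset.sum_neg_distrib, abs_neg])
    have h1 := add_mul_le_of_subgradient hζ i (-K - 1)
    have h2 := hB i
    have h3 := (abs_le.1 (hD i j)).2
    by_contra! hlt
    have h4 : ζ i < 0 := by linarith [hg i (K + 1), hg i (-K - 1)]
    nlinarith [hg i (P i), hg i (K + 1)]
  · obtain ⟨i, hi⟩ := exists_apply_le_of_abs_sum_le hn hK
    have h1 := add_mul_le_of_subgradient hζ i (K + 1)
    have h2 := hB i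
    have h3 := (abs_le.1 (hD i j)).1
    by_contra! hlt
    have h4 : 0 < ζ i := by linarith [hg i (K + 1), hg i (-K - 1)]
    nlinarith [hg i (P i), hg i (-K - 1)]

theorem inner_neg_laplacian_add {G : WeightedDigraph n} (hGb : G.WeightBalanced)
    (ζ : EuclideanSpace ℝ (Fin n)) (c : ℝ) :
    inner ℝ ζ (-(Matrix.toEuclideanLin G.laplacian ζ) +
      c • WithLp.toLp 2 (fun _ : Fin n => (1 : ℝ))) = -G.dirichletForm ζ + c * ∑ i, ζ i := by
  rw [← G.sum_mul_toEuclideanLin_laplacian hGb, PiLp.inner_apply, Finset.mul_sum,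
    ← Finset.sum_neg_distrib, ← Finset.sum_add_distrib]
  refine Finset.sum_congr rfl fun i _ => ?_
  simp
  ring

/-- Dissipation estimate: the mismatch term is absorbed by half of the dissipation. -/
theorem inner_neg_laplacian_add_le (hn : 1 ≤ n) {G : WeightedDigraph n} (hGb : G.WeightBalanced)
    {C : ℝ} (hC : 0 ≤ C) {ζ : EuclideanSpace ℝ (Fin n)} {B : ℝ}
    (hB : ∀ j, |ζ j| ≤ B + √(C * G.dirichletForm ζ)) (s : ℝ) :
    inner ℝ ζ (-(Matrix.toEuclideanLin G.laplacian ζ) +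
      (1 / (n : ℝ) * s) • WithLp.toLp 2 (fun _ : Fin n => (1 : ℝ))) ≤
      -(G.dirichletForm ζ / 2) + (|s| * B + C / 2 * s ^ 2) := by
  have hE := G.dirichletForm_nonneg ζ
  have hn' : (0 : ℝ) < n := by exact_mod_cast hn
  rw [inner_neg_laplacian_add hGb]
  have h1 : |∑ i, ζ i| ≤ n * (B + √(C * G.dirichletForm ζ)) := by
    refine (Finset.abs_sum_le_sum_abs _ _).trans
      ((Finset.sum_le_sum fun i _ => hB i).trans_eq ?_)
    simp [mul_add]
  have h2 : 1 / (n : ℝ) * s * ∑ i, ζ i ≤ |s| * (B + √(C * G.dirichletForm ζ)) := by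
    refine (le_abs_self _).trans ?_
    rw [abs_mul, abs_mul, abs_of_pos (by positivity : 0 < 1 / (n : ℝ))]
    calc 1 / (n : ℝ) * |s| * |∑ i, ζ i|
        ≤ 1 / (n : ℝ) * |s| * (n * (B + √(C * G.dirichletForm ζ))) := by gcongr
      _ = |s| * (B + √(C * G.dirichletForm ζ)) := by field_simp
  -- Young's inequality, leaving half of the dissipation.
  have h3 : |s| * √(C * G.dirichletForm ζ) ≤ C / 2 * s ^ 2 + G.dirichletForm ζ / 2 := by
    rw [Real.sqrt_mul hC]
    nlinarith [sq_nonneg (|s| * √C - √(G.dirichletForm ζ)), Real.sq_sqrt hC, Real.sq_sqrt hE,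
      sq_abs s]
  linarith

/-! ### Load mismatch along solutions -/

section Dynamics

variable {G : WeightedDigraph n} {f : Fin n → ℝ → ℝ} {Pm PM : EuclideanSpace ℝ (Fin n)}
  {Pl ε : ℝ} {P : ℝ → EuclideanSpace ℝ (Fin n)} {T : ℝ}

theorem sum_eq_of_mem_lmLapGradMap (hn : 1 ≤ n) (hGb : G.WeightBalanced)
    {x v : EuclideanSpace ℝ (Fin n)} (hv : v ∈ lmLapGradMap G f Pm PM Pl ε x) :
    ∑ i, v i = Pl - ∑ i, x i := by
  obtain ⟨ζ, -, rfl⟩ := hv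
  have hn' : (n : ℝ) ≠ 0 := by positivity
  simp only [PiLp.add_apply, PiLp.neg_apply, PiLp.smul_apply, Finset.sum_add_distrib,
    Finset.sum_neg_distrib, G.sum_toEuclideanLin_laplacian hGb]
  simp
  field_simp

/-- The load mismatch decays exponentially. -/
theorem load_mismatch_eq (hn : 1 ≤ n) (hGb : G.WeightBalanced) (hT : 0 < T)
    (hP : IsSolutionOn (lmLapGradMap G f Pm PM Pl ε) P T) {t : ℝ} (ht : t ∈ Icc 0 T) :
    Pl - ∑ i, P t i = Real.exp (-t) * (Pl - ∑ i, P 0 i) := by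
  obtain ⟨hac, hae⟩ := hP
  have h1 : AbsolutelyContinuousOnInterval (fun t => Pl - ∑ i, P t i) 0 T := by
    have hl : LocallyLipschitz fun x : EuclideanSpace ℝ (Fin n) => Pl - ∑ i, x i := by
      refine ContDiff.locallyLipschitz (𝕂 := ℝ) ?_
      fun_prop
    exact hl.comp_absolutelyContinuousOnInterval hac
  have h2 : AbsolutelyContinuousOnInterval Real.exp 0 T :=
    Real.contDiff_exp.contDiffOn.absolutelyContinuousOnInterval
  -- `e^t` is the integrating factor of `s' = -s`.
  have h3 : ∀ᵐ t, t ∈ uIcc 0 T →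
      HasDerivAt (Real.exp * fun t => Pl - ∑ i, P t i) 0 t := by
    rw [ae_restrict_iff' measurableSet_Icc] at hae
    rw [uIcc_of_le hT.le]
    filter_upwards [hae] with t ht htT
    obtain ⟨v, hv, hd⟩ := ht htT
    have hs : HasDerivAt (fun t => Pl - ∑ i, P t i) (-∑ i, v i) t := by
      refine (HasDerivAt.fun_sum fun i _ => ?_).const_sub Pl
      exact (hasDerivAt_pi.1 ((PiLp.hasFDerivAt_ofLp 2 (P t)).comp_hasDerivAt t hd)) i
    convert! (Real.hasDerivAt_exp t).mul hs using 1
    rw [sum_eq_of_mem_lmLapGradMap hn hGb hv]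
    ring
  obtain ⟨C, hC⟩ := (h2.mul h1).const_of_ae_hasDerivAt_zero h3
  rw [uIcc_of_le hT.le] at hC
  have e0 := hC 0 ⟨le_rfl, hT.le⟩
  have et := hC t ht
  simp only [Pi.mul_apply, Real.exp_zero, one_mul] at e0 et
  rw [e0, ← et, ← mul_assoc, ← Real.exp_add]
  simp

end Dynamics

/-! ### Decay of the penalized cost -/

theorem abs_penalizedCost_subgradient_le (hn : 1 ≤ n) {G : WeightedDigraph n}
    {f : Fin n → ℝ → ℝ} (hf : ∀ i x, 0 ≤ f i x) {Pm PM : EuclideanSpace ℝ (Fin n)} {ε : ℝ}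
    (hε : 0 < ε) {C : ℝ}
    (hCG : ∀ (ζ : EuclideanSpace ℝ (Fin n)) i j, (ζ i - ζ j) ^ 2 ≤ C * G.dirichletForm ζ)
    {x ζ : EuclideanSpace ℝ (Fin n)} {K : ℝ} (hK : |∑ i, x i| ≤ K)
    (hζ : ∀ y, penalizedCost f Pm PM ε x + inner ℝ ζ (y - x) ≤ penalizedCost f Pm PM ε y)
    (j : Fin n) :
    |ζ j| ≤ ∑ i, (unitCost f Pm PM ε i (K + 1) + unitCost f Pm PM ε i (-K - 1)) +
      √(C * G.dirichletForm ζ) := by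
  rw [penalizedCost_eq_totalCost] at hζ
  exact abs_subgradient_le hn (unitCost_nonneg hf Pm PM hε) hζ hK
    (fun i j => Real.abs_le_sqrt (hCG ζ i j)) j

/-- Suboptimality in terms of the disagreement of a subgradient and of the load mismatch. -/
theorem inner_sub_le_of_abs_le (hn : 1 ≤ n) {ζ x y : EuclideanSpace ℝ (Fin n)} {q b A : ℝ}
    (hq : ∀ i j, |ζ i - ζ j| ≤ q) (hb : ∀ i, |ζ i| ≤ b) (hA : ∀ i, |x i - y i| ≤ A) :
    inner ℝ ζ (x - y) ≤ q * (n * A) + b * |∑ i, x i - ∑ i, y i| := by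
  set o : Fin n := ⟨0, hn⟩
  have hq0 : 0 ≤ q := (abs_nonneg _).trans (hq o o)
  -- Splits `ζ` into its deviation from the entry at `o` and a multiple of `1`, which sees only the
  -- totals.
  have e : inner ℝ ζ (x - y) =
      ∑ i, (ζ i - ζ o) * (x i - y i) + ζ o * (∑ i, x i - ∑ i, y i) := by
    rw [PiLp.inner_apply, ← Finset.sum_sub_distrib, Finset.mul_sum, ← Finset.sum_add_distrib]
    refine Finset.sum_congr rfl fun i _ => ?_
    simp
    ring
  have h1 : ∑ i, (ζ i - ζ o) * (x i - y i) ≤ ∑ _i : Fin n, q * A := by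
    refine Finset.sum_le_sum fun i _ => (le_abs_self _).trans ?_
    rw [abs_mul]
    exact mul_le_mul (hq i o) (hA i) (abs_nonneg _) hq0
  have h2 : ζ o * (∑ i, x i - ∑ i, y i) ≤ b * |∑ i, x i - ∑ i, y i| := by
    refine (le_abs_self _).trans ?_
    rw [abs_mul]
    exact mul_le_mul_of_nonneg_right (hb o) (abs_nonneg _)
  have h3 : ∑ _i : Fin n, q * A = q * (n * A) := by
    simp
    ring
  linarith

section Dynamics

variable {G : WeightedDigraph n} {f : Fin n → ℝ → ℝ} {Pm PM : EuclideanSpace ℝ (Fin n)}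
  {Pl ε : ℝ} {P : ℝ → EuclideanSpace ℝ (Fin n)} {T : ℝ}

theorem abs_load_mismatch_le (hn : 1 ≤ n) (hGb : G.WeightBalanced) (hT : 0 < T)
    (hP : IsSolutionOn (lmLapGradMap G f Pm PM Pl ε) P T) {t : ℝ} (ht : t ∈ Icc 0 T) :
    |Pl - ∑ i, P t i| ≤ Real.exp (-t) * |Pl - ∑ i, P 0 i| := by
  rw [load_mismatch_eq hn hGb hT hP ht, abs_mul, Real.abs_exp]

theorem abs_sum_le (hn : 1 ≤ n) (hGb : G.WeightBalanced) (hT : 0 < T)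
    (hP : IsSolutionOn (lmLapGradMap G f Pm PM Pl ε) P T) {t : ℝ} (ht : t ∈ Icc 0 T) :
    |∑ i, P t i| ≤ |Pl| + |Pl - ∑ i, P 0 i| := by
  have h1 := abs_load_mismatch_le hn hGb hT hP ht
  have h2 : Real.exp (-t) ≤ 1 := Real.exp_le_one_iff.2 (by linarith [ht.1])
  have h3 := mul_le_mul_of_nonneg_right h2 (abs_nonneg (Pl - ∑ i, P 0 i))
  have h4 := abs_sub Pl (Pl - ∑ i, P t i)
  rw [sub_sub_cancel] at h4
  linarith

/-- The penalized cost decreases along solutions, up to an integrable error. -/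
theorem ae_deriv_penalizedCost_le (hn : 1 ≤ n) (hGb : G.WeightBalanced)
    (hf : ∀ i x, 0 ≤ f i x) (hf_convex : ∀ i, ConvexOn ℝ univ (f i)) (hε : 0 < ε) {C : ℝ}
    (hC : 0 ≤ C)
    (hCG : ∀ (ζ : EuclideanSpace ℝ (Fin n)) i j, (ζ i - ζ j) ^ 2 ≤ C * G.dirichletForm ζ)
    (hT : 0 < T) (hP : IsSolutionOn (lmLapGradMap G f Pm PM Pl ε) P T) {K B : ℝ}
    (hK : K = |Pl| + |Pl - ∑ i, P 0 i|)
    (hB : B = ∑ i, (unitCost f Pm PM ε i (K + 1) + unitCost f Pm PM ε i (-K - 1))) :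
    ∀ᵐ t, t ∈ Icc 0 T → ∃ ζ : EuclideanSpace ℝ (Fin n),
      (∀ y, penalizedCost f Pm PM ε (P t) + inner ℝ ζ (y - P t) ≤ penalizedCost f Pm PM ε y) ∧
      (DifferentiableAt ℝ (fun s => penalizedCost f Pm PM ε (P s)) t →
        deriv (fun s => penalizedCost f Pm PM ε (P s)) t ≤ -(G.dirichletForm ζ / 2) +
          (|Pl - ∑ i, P 0 i| * B + C / 2 * (Pl - ∑ i, P 0 i) ^ 2) * Real.exp (-t)) := by
  have hae := hP.2
  rw [ae_restrict_iff' measurableSet_Icc] at hae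
  filter_upwards [hae] with t ht htT
  obtain ⟨v, ⟨ζ, hζ, hv⟩, hd⟩ := ht htT
  have hsub := (convexOn_penalizedCost hf_convex Pm PM hε).add_inner_le_of_mem_generalizedGradient
    hζ
  refine ⟨ζ, hsub, fun hdiff => ?_⟩
  have hsum := abs_sum_le hn hGb hT hP htT
  rw [← hK] at hsum
  have hbound := abs_penalizedCost_subgradient_le hn hf hε hCG hsum hsub
  rw [← hB] at hbound
  have hB0 : 0 ≤ B := hB ▸ Finset.sum_nonneg fun i _ =>
    add_nonneg (unitCost_nonneg hf Pm PM hε i _) (unitCost_nonneg hf Pm PM hε i _)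
  rw [deriv_comp_eq_inner_of_subgradient hd hsub hdiff, hv]
  refine (inner_neg_laplacian_add_le hn hGb hC hbound _).trans ?_
  have hs := abs_load_mismatch_le hn hGb hT hP htT
  have he1 : Real.exp (-t) ≤ 1 := Real.exp_le_one_iff.2 (by linarith [htT.1])
  have he0 := Real.exp_pos (-t)
  have h1 := mul_le_mul_of_nonneg_right hs hB0
  -- `e^{-2t} ≤ e^{-t}` lets one exponential cover both error terms.
  have h2 : (Pl - ∑ i, P t i) ^ 2 ≤ Real.exp (-t) * (Pl - ∑ i, P 0 i) ^ 2 := by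
    rw [load_mismatch_eq hn hGb hT hP htT, mul_pow]
    exact mul_le_mul_of_nonneg_right (by nlinarith) (sq_nonneg _)
  have h3 := mul_le_mul_of_nonneg_left h2 (by positivity : 0 ≤ C / 2)
  linarith

/-- Integrated dissipation inequality, for a lower bound `δ` on the dissipation. -/
theorem penalizedCost_add_le (hn : 1 ≤ n) (hGb : G.WeightBalanced)
    (hf : ∀ i x, 0 ≤ f i x) (hf_convex : ∀ i, ConvexOn ℝ univ (f i)) (hε : 0 < ε) {C : ℝ}
    (hC : 0 ≤ C)
    (hCG : ∀ (ζ : EuclideanSpace ℝ (Fin n)) i j, (ζ i - ζ j) ^ 2 ≤ C * G.dirichletForm ζ)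
    (hT : 0 < T) (hP : IsSolutionOn (lmLapGradMap G f Pm PM Pl ε) P T) {K B L : ℝ}
    (hK : K = |Pl| + |Pl - ∑ i, P 0 i|)
    (hB : B = ∑ i, (unitCost f Pm PM ε i (K + 1) + unitCost f Pm PM ε i (-K - 1)))
    (hL : L = |Pl - ∑ i, P 0 i| * B + C / 2 * (Pl - ∑ i, P 0 i) ^ 2) {a b δ : ℝ}
    (ha : 0 ≤ a) (hab : a ≤ b) (hb : b ≤ T)
    (hδ : ∀ t ∈ Icc a b, ∀ ζ : EuclideanSpace ℝ (Fin n),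
      (∀ y, penalizedCost f Pm PM ε (P t) + inner ℝ ζ (y - P t) ≤ penalizedCost f Pm PM ε y) →
      δ ≤ G.dirichletForm ζ) :
    penalizedCost f Pm PM ε (P b) + (L * Real.exp (-b) + δ / 2 * b) ≤
      penalizedCost f Pm PM ε (P a) + (L * Real.exp (-a) + δ / 2 * a) := by
  have hsubset : Icc a b ⊆ Icc 0 T := Icc_subset_Icc ha hb
  have hac : AbsolutelyContinuousOnInterval (fun t => penalizedCost f Pm PM ε (P t)) a b := by
    refine (convexOn_penalizedCost hf_convex Pm PM
      hε).locallyLipschitz.comp_absolutelyContinuousOnInterval (hP.1.mono ?_)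
    rwa [uIcc_of_le hab, uIcc_of_le hT.le]
  have hψ : ContDiff ℝ 1 fun t => L * Real.exp (-t) + δ / 2 * t := by fun_prop
  refine (hac.add hψ.contDiffOn.absolutelyContinuousOnInterval).le_of_ae_deriv_nonpos hab ?_
  filter_upwards [ae_deriv_penalizedCost_le hn hGb hf hf_convex hε hC hCG hT hP hK hB]
    with t ht htab hdiff
  obtain ⟨ζ, hsub, hle⟩ := ht (hsubset htab)
  have hψd : HasDerivAt (fun t => L * Real.exp (-t) + δ / 2 * t) (-(L * Real.exp (-t)) + δ / 2)
      t := by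
    have h1 := ((Real.hasDerivAt_exp (-t)).comp t (hasDerivAt_neg t)).const_mul L
    have h2 := (hasDerivAt_id t).const_mul (δ / 2)
    convert! h1.add h2 using 1
    ring
  -- `hdiff` concerns the sum; subtracting the smooth correction isolates the cost.
  have hφ : DifferentiableAt ℝ (fun t => penalizedCost f Pm PM ε (P t)) t := by
    have := hdiff.sub hψd.differentiableAt
    rwa [add_sub_cancel_right] at this
  rw [(hφ.hasDerivAt.add hψd).deriv]
  have := hle hφ
  rw [← hL] at this
  linarith [hδ t htab ζ hsub]

theorem penalizedCost_nonneg (hf : ∀ i x, 0 ≤ f i x) (hε : 0 < ε)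
    (x : EuclideanSpace ℝ (Fin n)) : 0 ≤ penalizedCost f Pm PM ε x := by
  rw [penalizedCost_eq_totalCost]
  exact Finset.sum_nonneg fun i _ => unitCost_nonneg hf Pm PM hε i _

/-- Solutions are bounded, uniformly for a given initial condition. -/
theorem exists_norm_le (hn : 1 ≤ n) (hG : G.StronglyConnected) (hGb : G.WeightBalanced)
    (hf : ∀ i x, 0 ≤ f i x) (hf_convex : ∀ i, ConvexOn ℝ univ (f i)) (hε : 0 < ε)
    (P₀ : EuclideanSpace ℝ (Fin n)) :
    ∃ R : ℝ, ∀ T > 0, ∀ P : ℝ → EuclideanSpace ℝ (Fin n),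
      IsSolutionOn (lmLapGradMap G f Pm PM Pl ε) P T → P 0 = P₀ →
        ∀ t ∈ Icc 0 T, ‖P t‖ ≤ R := by
  obtain ⟨C, hC, hCG⟩ := hG.exists_sq_sub_le
  obtain ⟨K, hK⟩ : ∃ K, K = |Pl| + |Pl - ∑ i, P₀ i| := ⟨_, rfl⟩
  obtain ⟨B, hB⟩ : ∃ B, B = ∑ i, (unitCost f Pm PM ε i (K + 1) + unitCost f Pm PM ε i (-K - 1)) :=
    ⟨_, rfl⟩
  obtain ⟨L, hL⟩ : ∃ L, L = |Pl - ∑ i, P₀ i| * B + C / 2 * (Pl - ∑ i, P₀ i) ^ 2 := ⟨_, rfl⟩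
  have hB0 : 0 ≤ B := hB ▸ Finset.sum_nonneg fun i _ =>
    add_nonneg (unitCost_nonneg hf Pm PM hε i _) (unitCost_nonneg hf Pm PM hε i _)
  have hL0 : 0 ≤ L := by rw [hL]; positivity
  refine ⟨∑ i, (|Pm i| + |PM i| + ε * (penalizedCost f Pm PM ε P₀ + L)), ?_⟩
  rintro T hT P hP rfl t ht
  have h := penalizedCost_add_le (δ := 0) hn hGb hf hf_convex hε hC hCG hT hP hK hB hL le_rfl
    ht.1 ht.2 fun t _ ζ _ => G.dirichletForm_nonneg ζ
  have h1 : 0 ≤ L * Real.exp (-t) := by positivity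
  refine norm_le_of_penalizedCost_le hf Pm PM hε ?_
  simp only [neg_zero, Real.exp_zero] at h
  linarith

/-- Along a trajectory, the penalized cost eventually does not exceed the optimal cost by more
than any prescribed amount. -/
theorem eventually_penalizedCost_le (hn : 1 ≤ n) (hG : G.StronglyConnected)
    (hGb : G.WeightBalanced) (hf : ∀ i x, 0 ≤ f i x) (hf_convex : ∀ i, ConvexOn ℝ univ (f i))
    (hε : 0 < ε) (hP : IsTrajectory (lmLapGradMap G f Pm PM Pl ε) P)
    {Q : EuclideanSpace ℝ (Fin n)} (hQ : Q ∈ feasibleSet Pm PM Pl) {η : ℝ} (hη : 0 < η) :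
    ∀ᶠ t in atTop, penalizedCost f Pm PM ε (P t) ≤ totalCost f Q + η := by
  obtain ⟨C, hC, hCG⟩ := hG.exists_sq_sub_le
  obtain ⟨R, hR⟩ := exists_norm_le (Pm := Pm) (PM := PM) (Pl := Pl) hn hG hGb hf hf_convex hε (P 0)
  obtain ⟨K, hK⟩ : ∃ K, K = |Pl| + |Pl - ∑ i, P 0 i| := ⟨_, rfl⟩
  obtain ⟨B, hB⟩ : ∃ B, B = ∑ i, (unitCost f Pm PM ε i (K + 1) + unitCost f Pm PM ε i (-K - 1)) :=
    ⟨_, rfl⟩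
  obtain ⟨L, hL⟩ : ∃ L, L = |Pl - ∑ i, P 0 i| * B + C / 2 * (Pl - ∑ i, P 0 i) ^ 2 := ⟨_, rfl⟩
  have hB0 : 0 ≤ B := hB ▸ Finset.sum_nonneg fun i _ =>
    add_nonneg (unitCost_nonneg hf Pm PM hε i _) (unitCost_nonneg hf Pm PM hε i _)
  have hL0 : 0 ≤ L := by rw [hL]; positivity
  have hdec : ∀ {a b δ : ℝ}, 0 ≤ a → a ≤ b → (∀ t ∈ Icc a b, ∀ ζ : EuclideanSpace ℝ (Fin n),
      (∀ y, penalizedCost f Pm PM ε (P t) + inner ℝ ζ (y - P t) ≤ penalizedCost f Pm PM ε y) →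
      δ ≤ G.dirichletForm ζ) →
      penalizedCost f Pm PM ε (P b) + (L * Real.exp (-b) + δ / 2 * b) ≤
        penalizedCost f Pm PM ε (P a) + (L * Real.exp (-a) + δ / 2 * a) := fun {a b δ} ha hab h =>
    penalizedCost_add_le hn hGb hf hf_convex hε hC hCG (by linarith : 0 < b + 1)
      (hP _ (by linarith)) hK hB hL ha hab (by linarith) h
  -- Dissipation at least `δ` forever would exhaust a nonnegative cost.
  have hgood : ∀ k ≥ (0 : ℝ), ∀ δ > (0 : ℝ), ∃ t ≥ k, ∃ ζ : EuclideanSpace ℝ (Fin n),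
      (∀ y, penalizedCost f Pm PM ε (P t) + inner ℝ ζ (y - P t) ≤ penalizedCost f Pm PM ε y) ∧
      G.dirichletForm ζ < δ := by
    intro k hk δ hδ
    by_contra! hcon
    set c := penalizedCost f Pm PM ε (P k) + L * Real.exp (-k) + 1 with hc
    have hc0 : 0 < c := by
      have := penalizedCost_nonneg (Pm := Pm) (PM := PM) hf hε (P k)
      positivity
    -- Over a time `2c/δ` at rate `δ/2` the loss is `c`, one more than is available.
    have h := hdec (b := k + 2 * c / δ) hk (le_add_of_nonneg_right (by positivity))
      fun t ht ζ hζ => hcon t ht.1 ζ hζ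
    have h1 := penalizedCost_nonneg (Pm := Pm) (PM := PM) hf hε (P (k + 2 * c / δ))
    have h2 : 0 ≤ L * Real.exp (-(k + 2 * c / δ)) := by positivity
    have h3 : δ / 2 * (k + 2 * c / δ) = δ / 2 * k + c := by field_simp
    linarith
  set A := R + ‖Q‖
  set S := |Pl - ∑ i, P 0 i| with hS
  -- Total error when both the Dirichlet form and the mismatch factor are at most `u`. It is
  -- continuous with `ρ 0 = 0`; `u = e^{-k}` serves both purposes.
  let ρ : ℝ → ℝ := fun u => √(C * u) * (n * A) + (B + √(C * u)) * (u * S) + L * u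
  have hρ : Tendsto (fun k => ρ (Real.exp (-k))) atTop (𝓝 0) := by
    have hc : Continuous ρ := by fun_prop
    have := (hc.tendsto 0).comp (Real.tendsto_exp_neg_atTop_nhds_zero)
    simpa [ρ, Function.comp_def] using this
  obtain ⟨k, hk, hk0⟩ := ((hρ.eventually (gt_mem_nhds hη)).and (eventually_ge_atTop 0)).exists
  obtain ⟨t, hkt, ζ, hsub, hE⟩ := hgood k hk0 _ (Real.exp_pos (-k))
  have ht0 : 0 ≤ t := hk0.trans hkt
  have hsol := hP (t + 1) (by linarith)
  have htT : t ∈ Icc 0 (t + 1) := ⟨ht0, by linarith⟩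
  have hsum := abs_sum_le hn hGb (by linarith) hsol htT
  rw [← hS, ← hK] at hsum
  have hbound := abs_penalizedCost_subgradient_le hn hf hε hCG hsum hsub
  rw [← hB] at hbound
  have hmono : √(C * G.dirichletForm ζ) ≤ √(C * Real.exp (-k)) :=
    Real.sqrt_le_sqrt (mul_le_mul_of_nonneg_left hE.le hC)
  have hexp : Real.exp (-t) ≤ Real.exp (-k) := Real.exp_le_exp.2 (by linarith)
  have hA : ∀ i, |P t i - Q i| ≤ A := fun i => by
    have h1 := PiLp.norm_apply_le (P t) i
    have h2 := PiLp.norm_apply_le Q i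
    have h3 := hR _ (by linarith) P hsol rfl t htT
    rw [Real.norm_eq_abs] at h1 h2
    linarith [abs_sub (P t i) (Q i)]
  have hinner := inner_sub_le_of_abs_le hn
    (fun i j => (Real.abs_le_sqrt (hCG ζ i j)).trans hmono)
    (fun i => (hbound i).trans (add_le_add_right hmono B)) hA
  have hmis : |∑ i, P t i - ∑ i, Q i| ≤ Real.exp (-k) * S := by
    rw [hQ.2, abs_sub_comm]
    exact (abs_load_mismatch_le hn hGb (by linarith) hsol htT).trans
      (mul_le_mul_of_nonneg_right hexp (abs_nonneg _))
  have hmis' := mul_le_mul_of_nonneg_left hmis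
    (by positivity : 0 ≤ B + √(C * Real.exp (-k)))
  have hQcost : penalizedCost f Pm PM ε Q = totalCost f Q := by
    rw [penalizedCost_eq_add, boxPenalty_eq_zero hQ.1, mul_zero, add_zero]
  have hsubQ := hsub Q
  rw [hQcost, ← neg_sub, inner_neg_right] at hsubQ
  have hLe := mul_le_mul_of_nonneg_left hexp hL0
  -- One good time suffices: monotonicity of `V + L e^{-t}` carries the bound to all later times.
  filter_upwards [eventually_ge_atTop t] with b hb
  have h := hdec (δ := 0) ht0 hb fun t _ ζ _ => G.dirichletForm_nonneg ζ
  have h1 : 0 ≤ L * Real.exp (-b) := by positivity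
  simp only [ρ] at hk
  linarith

end Dynamics

end EconomicDispatch

/-! ### Convergence to the minimizers -/

theorem mainTheorem2 (n : ℕ) (hn : 1 ≤ n)
    (G : WeightedDigraph n) (hG : G.StronglyConnected) (hGb : G.WeightBalanced)
    (f : Fin n → ℝ → ℝ) (hf_nonneg : ∀ i x, 0 ≤ f i x)
    (hf_convex : ∀ i, ConvexOn ℝ univ (f i)) (hf_C1 : ∀ i, ContDiff ℝ 1 (f i))
    (Pm PM : EuclideanSpace ℝ (Fin n)) (Pl : ℝ) (hPl : 0 < Pl)
    (hfeas : (EconomicDispatch.feasibleSet Pm PM Pl).Nonempty)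
    (hPm : Pm ∉ EconomicDispatch.feasibleSet Pm PM Pl)
    (hPM : PM ∉ EconomicDispatch.feasibleSet Pm PM Pl)
    (ε : ℝ) (hε : 0 < ε)
    (hε_lt : ∀ P ∈ EconomicDispatch.feasibleSet Pm PM Pl,
      ε * (2 * ‖WithLp.ofLp (gradient (EconomicDispatch.totalCost f) P)‖) < 1) :
    (EconomicDispatch.solutionSet f Pm PM Pl).Nonempty ∧
    ∀ P₀ : EuclideanSpace ℝ (Fin n),
      (∃ R : ℝ, ∀ T > 0, ∀ P : ℝ → EuclideanSpace ℝ (Fin n),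
        IsSolutionOn (EconomicDispatch.lmLapGradMap G f Pm PM Pl ε) P T → P 0 = P₀ →
          ∀ t ∈ Icc 0 T, ‖P t‖ ≤ R) ∧
      ∀ P : ℝ → EuclideanSpace ℝ (Fin n),
        IsTrajectory (EconomicDispatch.lmLapGradMap G f Pm PM Pl ε) P → P 0 = P₀ →
          (∀ t, 0 ≤ t → Pl - ∑ i, P t i = Real.exp (-t) * (Pl - ∑ i, P₀ i)) ∧
          Tendsto (fun t => Metric.infDist (P t) (EconomicDispatch.solutionSet f Pm PM Pl))
            atTop (𝓝 0) := by
  have hsol := EconomicDispatch.solutionSet_nonempty hf_C1 hfeas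
  refine ⟨hsol, fun P₀ => ?_⟩
  have hbdd := EconomicDispatch.exists_norm_le (Pm := Pm) (PM := PM) (Pl := Pl) hn hG hGb
    hf_nonneg hf_convex hε P₀
  refine ⟨hbdd, ?_⟩
  rintro P hP rfl
  have hload : ∀ t, 0 ≤ t → Pl - ∑ i, P t i = Real.exp (-t) * (Pl - ∑ i, P 0 i) := fun t ht =>
    EconomicDispatch.load_mismatch_eq hn hGb (by linarith) (hP (t + 1) (by linarith))
      ⟨ht, by linarith⟩
  refine ⟨hload, ?_⟩
  obtain ⟨R, hR⟩ := hbdd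
  obtain ⟨Q, hQ⟩ := hsol
  have hload_tendsto : Tendsto (fun t => Pl - ∑ i, P t i) atTop (𝓝 0) := by
    have h := Real.tendsto_exp_neg_atTop_nhds_zero.mul_const (Pl - ∑ i, P 0 i)
    rw [zero_mul] at h
    refine h.congr' ?_
    filter_upwards [eventually_ge_atTop 0] with t ht
    exact (hload t ht).symm
  have hcont : Continuous (EconomicDispatch.penalizedCost f Pm PM ε) :=
    (EconomicDispatch.convexOn_penalizedCost hf_convex Pm PM hε).locallyLipschitz.continuous
  -- Along any ultrafilter finer than `atTop`, boundedness makes `P` converge; only its limit has to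
  -- be shown optimal.
  rw [tendsto_iff_ultrafilter]
  intro g hg
  have hball : ((g.map P : Ultrafilter (EuclideanSpace ℝ (Fin n))) :
      Filter (EuclideanSpace ℝ (Fin n))) ≤
      𝓟 (Metric.closedBall (0 : EuclideanSpace ℝ (Fin n)) R) := by
    rw [le_principal_iff]
    refine hg ?_
    filter_upwards [eventually_ge_atTop 0] with t ht
    simpa using hR (t + 1) (by linarith) P (hP _ (by linarith)) rfl t ⟨ht, by linarith⟩
  obtain ⟨x, -, hx⟩ := (isCompact_closedBall (0 : EuclideanSpace ℝ (Fin n)) R).ultrafilter_le_nhds _ hball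
  have hPx : Tendsto P g (𝓝 x) := hx
  have hxsum : ∑ i, x i = Pl := by
    have hc : Continuous fun y : EuclideanSpace ℝ (Fin n) => Pl - ∑ i, y i := by fun_prop
    have := tendsto_nhds_unique ((hc.tendsto x).comp hPx) (hload_tendsto.mono_left hg)
    linarith
  have hxcost : EconomicDispatch.penalizedCost f Pm PM ε x ≤ EconomicDispatch.totalCost f Q :=
    le_of_forall_pos_le_add fun η hη => le_of_tendsto ((hcont.tendsto x).comp hPx)
      (hg (EconomicDispatch.eventually_penalizedCost_le hn hG hGb hf_nonneg hf_convex hε hP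
        hQ.1 hη))
  have hxsol := EconomicDispatch.mem_solutionSet_of_penalizedCost_le hf_convex hf_C1 hε hε_lt hQ
    hxsum hxcost
  have hdist := ((Metric.continuous_infDist_pt
    (EconomicDispatch.solutionSet f Pm PM Pl)).tendsto x).comp hPx
  rwa [Metric.infDist_zero_of_mem hxsol] at hdist
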